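/- Let $K\ge 1$, $\epsilon>0$, $\kappa\in(0,1)$, $[K]=\{1,\dots,K\}$, and let $\Delta=\{\theta\in\mathbb R^K:\ \theta_k\ge 0,\ \sum_k\theta_k=1\}$ with the Euclidean norm; $\mathrm d\theta$ denotes Lebesgue measure in the coordinates $(\theta_1,\dots,\theta_{K-1})$ restricted to $\Delta$. *Mechanism.* For $x\in A\subseteq[K]$ let $\mathrm{SRR}(x;A,e)$ equal $x$ with probability $e^{e}/(e^{e}+|A|-1)$ and otherwise be uniform on $A\setminus\{x\}$. For $S\subsetneq[K]$ with complement $S^c$, put $\epsilon_1=\kappa\epsilon$, and $\epsilon_2=\min\{\epsilon,\ln\frac{|S^c|-1}{e^{\epsilon_1-\epsilon}|S^c|-1}\}$ if $S\neq\emptyset$ and $\epsilon-\epsilon_1<\ln|S^c|$, $\epsilon_2=\epsilon$ otherwise. The response $\mathrm{RRRR}(x;S,\epsilon)$ is $\mathrm{SRR}(x;S\cup\{R\},\epsilon_1)$ with $R$ uniform on $S^c$ if $x\in S$, and $\mathrm{SRR}(R;S\cup\{R\},\epsilon_1)$ with $R=\mathrm{SRR}(x;S^c,\epsilon_2)$ if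 $x\notin S$. Let $g_{S,\epsilon}(y\mid x)$ be the probability that $\mathrm{RRRR}(x;S,\epsilon)=y$, and $h_{S,\epsilon}(y\mid\theta)=\sum_{x}g_{S,\epsilon}(y\mid x)\theta_x$. *Subset selection.* Let $U(\theta,S,\epsilon)\in\mathbb R$ be any utility function. For $\theta\in\Delta$ let $\sigma_\theta$ be a permutation with $\theta_{\sigma_\theta(1)}\ge\dots\ge\theta_{\sigma_\theta(K)}$, and let $S^*_\theta=\{\sigma_\theta(1),\dots,\sigma_\theta(k)\}$, where $k$ maximizes $U(\theta,\{\sigma_\theta(1),\dots,\sigma_\theta(k)\},\epsilon)$ over $k\in\{0,\dots,K-1\}$; ties are broken in any way that makes $\theta\mapsto S^*_\theta$ measurable. *Algorithm.* Let $\theta^*,\theta_{\mathrm{init}}\in\Delta$, and let $Q$ be any family of Markov kernels $Q(\cdot\mid Y_{1:n},S_{1:n},\Theta_{n-1})$ on $\Delta$, $n\ge1$. Let $P_{\theta^*}$ be the law of the sequence given by $\Theta_0=\theta_{\mathrm{init}}$ and, for $t\ge 1$: $S_t=S^*_{\Theta_{t-1}}$; given the past, $Y_t=\mathrm{RRRR}(X_t;S_t,\epsilon)$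 with $X_t\sim\mathrm{Cat}(\theta^*)$ drawn independently of the past, so that $Y_t$ has probabilities $h_{S_t,\epsilon}(\cdot\mid\theta^*)$; and $\Theta_t\sim Q(\cdot\mid Y_{1:t},S_{1:t},\Theta_{t-1})$. *Posterior.* For a probability density $\eta$ on $\Delta$ with respect to $\mathrm d\theta$ and measurable $A\subseteq\Delta$ let $$\Pi(A\mid Y_{1:n},S_{1:n})=\frac{\int_A\eta(\theta)\prod_{t=1}^n h_{S_t,\epsilon}(Y_t\mid\theta)\,\mathrm d\theta}{\int_\Delta\eta(\theta)\prod_{t=1}^n h_{S_t,\epsilon}(Y_t\mid\theta)\,\mathrm d\theta}.$$ **Theorem.** There is a constant $c>0$, depending only on $K,\epsilon,\kappa$, such that the following holds for all $\theta^*,\theta_{\mathrm{init}}\in\Delta$, all utility functions $U$ and selections $S^*_\theta$ as above, all kernels $Q$, and all prior densities $\eta$ for which there are $d,B>0$ such that $\eta(\theta')>0$ and $\eta(\theta)/\eta(\theta')<B$ for all $\theta,\theta'\in\Delta$ with $\|\theta'-\theta^*\|<d$. For every $a\in(0,1)$, with $\Omega_n=\{\theta\in\Delta:\|\theta-\theta^*\|^2\le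 c\,n^{-a}\}$, $$\Pi(\Omega_n\mid Y_{1:n},S_{1:n})\longrightarrow 1\quad\text{in } P_{\theta^*}\text{-probability as } n\to\infty.$$ -/

import Mathlib

open MeasureTheory ProbabilityTheory Filter

noncomputable section

namespace AdOBEst

/-- The probability simplex `Δ` of probability vectors over `K = N + 1` categories, as a subspace
of Euclidean space. The category set `[K]` is `Fin (N + 1)`. -/
abbrev Simplex (N : ℕ) : Type :=
  {θ : EuclideanSpace ℝ (Fin (N + 1)) // (∑ k, θ k = 1) ∧ ∀ k, 0 ≤ θ k}

/-- The proper subsets `S ⊂ [K]`. -/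
abbrev ProperSubset (N : ℕ) : Type :=
  {S : Finset (Fin (N + 1)) // S ≠ Finset.univ}

theorem compl_nonempty {N : ℕ} (S : ProperSubset N) : (S.1ᶜ).Nonempty := by
  rw [Finset.nonempty_iff_ne_empty]
  intro h
  exact S.2 (by simpa using h)

/-- The first `K - 1` coordinates `ϑ` of a probability vector `θ`. -/
def freeCoords {N : ℕ} (θ : Simplex N) : Fin N → ℝ := fun i => θ.1 i.castSucc

/-- The reference measure `dθ` on `Δ`: Lebesgue measure of the free coordinates `ϑ`. -/
def lebesgueSimplex (N : ℕ) : Measure (Simplex N) :=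
  Measure.comap freeCoords volume

/-! ### The randomized response mechanisms -/

/-- A coin that shows `true` with probability `p / (p + m)`. -/
def coin (p : ℝ) (hp : 0 < p) (m : ℕ) : PMF Bool :=
  PMF.ofFintype
    (fun b => cond b (ENNReal.ofReal (p / (p + m))) (ENNReal.ofReal (1 - p / (p + m)))) (by
      have h0 : (0 : ℝ) ≤ m := Nat.cast_nonneg m
      have h1 : p / (p + m) ≤ 1 := (div_le_one (by linarith)).2 (by linarith)
      have h2 : 0 ≤ p / (p + m) := div_nonneg hp.le (by linarith)
      simp only [Fintype.sum_bool, cond_true, cond_false]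
      rw [← ENNReal.ofReal_add h2 (by linarith)]
      simp)

/-- Standard randomized response `SRR(x; A, e)` on the set `A` (with `x ∈ A`): the output is `x`
with probability `exp e / (exp e + |A| - 1)`, and otherwise is uniform on `A \ {x}`. If
`A \ {x}` is empty, the second case has probability zero. -/
def srr {N : ℕ} (A : Finset (Fin (N + 1))) (e : ℝ) (x : Fin (N + 1)) : PMF (Fin (N + 1)) :=
  (coin (Real.exp e) (Real.exp_pos e) (A.card - 1)).bind fun honest =>
    if honest then PMF.pure x
    else if hA : (A.erase x).Nonempty then PMF.uniformOfFinset (A.erase x) hA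
    else PMF.pure x

/-- The randomly restricted randomized response mechanism with subset `S` and privacy parameters
`e₁`, `e₂`, on input `x`. -/
def rrrr {N : ℕ} (S : ProperSubset N) (e₁ e₂ : ℝ) (x : Fin (N + 1)) : PMF (Fin (N + 1)) :=
  if x ∈ S.1 then
    (PMF.uniformOfFinset S.1ᶜ (compl_nonempty S)).bind fun r => srr (insert r S.1) e₁ x
  else
    (srr S.1ᶜ e₂ x).bind fun r => srr (insert r S.1) e₁ r

/-- The second privacy parameter `ε₂`, as a function of `ε`, `ε₁` and `S`. -/
def eps₂ {N : ℕ} (ε ε₁ : ℝ) (S : ProperSubset N) : ℝ :=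
  if ε - ε₁ < Real.log ((S.1ᶜ).card : ℝ) ∧ 0 < S.1.card then
    min ε (Real.log ((((S.1ᶜ).card : ℝ) - 1) / (Real.exp (ε₁ - ε) * ((S.1ᶜ).card : ℝ) - 1)))
  else ε

/-- `RRRR(x; S, ε)`: the mechanism with `ε₁ = κ ε` and the corresponding `ε₂`. -/
def mechanism {N : ℕ} (ε κ : ℝ) (S : ProperSubset N) (x : Fin (N + 1)) : PMF (Fin (N + 1)) :=
  rrrr S (κ * ε) (eps₂ ε (κ * ε) S) x

/-- `g_{S,ε}(y | x)`, the probability of the response `y` on input `x`. -/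
def g {N : ℕ} (ε κ : ℝ) (S : ProperSubset N) (y x : Fin (N + 1)) : ℝ :=
  (mechanism ε κ S x y).toReal

/-- `h_{S,ε}(y | θ) = ∑ₓ g_{S,ε}(y | x) θₓ`. -/
def h {N : ℕ} (ε κ : ℝ) (S : ProperSubset N) (y : Fin (N + 1)) (θ : Simplex N) : ℝ :=
  ∑ x, g ε κ S y x * θ.1 x

/-- The categorical distribution `Cat(θ)`. -/
def cat {N : ℕ} (θ : Simplex N) : PMF (Fin (N + 1)) :=
  PMF.ofFintype (fun k => ENNReal.ofReal (θ.1 k)) (by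
    rw [← ENNReal.ofReal_sum_of_nonneg fun k _ => θ.2.2 k, θ.2.1, ENNReal.ofReal_one])

/-- The law of `Y = RRRR(X; S, ε)` when `X ∼ Cat(θ)`. -/
def responseLaw {N : ℕ} (ε κ : ℝ) (θ : Simplex N) (S : ProperSubset N) : PMF (Fin (N + 1)) :=
  (cat θ).bind fun x => mechanism ε κ S x

/-! ### Subset selection -/

/-- `{σ(1), …, σ(k)}`, for `k ∈ {0, …, K - 1}`. -/
def topSubset {N : ℕ} (σ : Equiv.Perm (Fin (N + 1))) (k : Fin (N + 1)) : ProperSubset N :=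
  ⟨(Finset.univ.filter fun i => i < k).image σ, by
    intro hu
    have hm : σ k ∈ (Finset.univ.filter fun i => i < k).image σ := by
      rw [hu]; exact Finset.mem_univ _
    simp at hm⟩

/-- `sel θ` is a best subset `S*_θ` for the utility `U`, for every `θ`: it consists of the `k`
categories of largest probability, in an order `σ` in which the entries of `θ` are non-increasing,
where `k` maximizes the utility of such subsets over `{0, …, K - 1}`. Ties are broken
arbitrarily. -/
def IsBestSubsetRule {N : ℕ} (U : Simplex N → ProperSubset N → ℝ → ℝ) (ε : ℝ)
    (sel : Simplex N → ProperSubset N) : Prop :=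
  ∀ θ : Simplex N, ∃ σ : Equiv.Perm (Fin (N + 1)), ∃ k : Fin (N + 1),
    (∀ i j, i ≤ j → θ.1 (σ j) ≤ θ.1 (σ i)) ∧
    (∀ j, U θ (topSubset σ j) ε ≤ U θ (topSubset σ k) ε) ∧
    sel θ = topSubset σ k

/-! ### The prior and the posterior -/

/-- `η` is a probability density on `Δ` with respect to `dθ`. -/
structure IsPriorDensity {N : ℕ} (η : Simplex N → ℝ) : Prop where
  measurable : Measurable η
  nonneg : ∀ θ, 0 ≤ η θ
  integral_eq_one : ∫ θ, η θ ∂(lebesgueSimplex N) = 1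

/-- The prior density ratio `η(θ) / η(θ')` is bounded for `θ'` near `θstar`. That the ratio is
meaningful, i.e. `η(θ') > 0`, is part of the condition. -/
def PriorRatioBounded {N : ℕ} (η : Simplex N → ℝ) (θstar : Simplex N) : Prop :=
  ∃ d > 0, ∃ B > 0, ∀ θ θ' : Simplex N, ‖θ'.1 - θstar.1‖ < d → 0 < η θ' ∧ η θ / η θ' < B

/-- Data `(S₁, Y₁), …, (Sₙ, Yₙ)`. -/
abbrev Data (N n : ℕ) : Type := Fin n → ProperSubset N × Fin (N + 1)

/-- The posterior probability `Π(A | Y_{1:n}, S_{1:n})`. -/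
def posterior {N : ℕ} (ε κ : ℝ) (η : Simplex N → ℝ) {n : ℕ} (D : Data N n)
    (A : Set (Simplex N)) : ℝ :=
  (∫ θ in A, η θ * ∏ t, h ε κ (D t).1 (D t).2 θ ∂(lebesgueSimplex N)) /
    (∫ θ, η θ * ∏ t, h ε κ (D t).1 (D t).2 θ ∂(lebesgueSimplex N))

/-! ### The law of the algorithm -/

/-- The record `(Θ_t, S_{t+1}, Y_{t+1})`, for `t = 0, 1, 2, …`. -/
abbrev Record (N : ℕ) : Type := Simplex N × ProperSubset N × Fin (N + 1)

/-- The data `(S₁, Y₁), …, (Sₙ, Yₙ)` of a trajectory of records. -/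
def data {N : ℕ} (n : ℕ) (ω : ℕ → Record N) : Data N n := fun i => (ω i).2

/-- The data `(S₁, Y₁), …, (S_{n+1}, Y_{n+1})` and the sample `Θ_n` contained in the records
at times `0, …, n`. -/
def history {N : ℕ} (n : ℕ) (r : (i : Finset.Iic n) → Record N) : Data N (n + 1) × Simplex N :=
  (fun i => (r ⟨i, Finset.mem_Iic.2 (Nat.lt_succ_iff.1 i.2)⟩).2,
    (r ⟨n, Finset.mem_Iic.2 le_rfl⟩).1)

theorem measurable_history {N : ℕ} (n : ℕ) : Measurable (history (N := N) n) := by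
  unfold history
  fun_prop

/-- Given `Θ_t = θ`, set `S_{t+1} = sel θ` and draw `Y_{t+1} = RRRR(X; S_{t+1}, ε)` with
`X ∼ Cat(θstar)`. -/
def observe {N : ℕ} (ε κ : ℝ) (θstar : Simplex N) (sel : Simplex N → ProperSubset N)
    (hsel : Measurable sel) : Kernel (Simplex N) (Record N) :=
  Kernel.deterministic id measurable_id ×ₖ
    ((Kernel.deterministic sel hsel) ⊗ₖ
      Kernel.prodMkLeft (Simplex N)
        (Kernel.ofFunOfCountable fun S => (responseLaw ε κ θstar S).toMeasure))

instance {N : ℕ} (ε κ : ℝ) (θstar : Simplex N) (sel : Simplex N → ProperSubset N)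
    (hsel : Measurable sel) : IsMarkovKernel (observe ε κ θstar sel hsel) := by
  have : IsMarkovKernel (Kernel.ofFunOfCountable fun S : ProperSubset N =>
      (responseLaw ε κ θstar S).toMeasure) := ⟨fun S => by
    change IsProbabilityMeasure (responseLaw ε κ θstar S).toMeasure
    infer_instance⟩
  unfold observe
  infer_instance

/-- One step of the algorithm: draw
`Θ_{n+1} ∼ Q(· | Y_{1:n+1}, S_{1:n+1}, Θ_n)`, then generate `S_{n+2}` and `Y_{n+2}`. -/
def step {N : ℕ} (ε κ : ℝ) (θstar : Simplex N) (sel : Simplex N → ProperSubset N)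
    (hsel : Measurable sel) (Q : (n : ℕ) → Kernel (Data N n × Simplex N) (Simplex N)) (n : ℕ) :
    Kernel ((i : Finset.Iic n) → Record N) (Record N) :=
  observe ε κ θstar sel hsel ∘ₖ (Q (n + 1)).comap (history n) (measurable_history n)

instance {N : ℕ} (ε κ : ℝ) (θstar : Simplex N) (sel : Simplex N → ProperSubset N)
    (hsel : Measurable sel) (Q : (n : ℕ) → Kernel (Data N n × Simplex N) (Simplex N))
    [∀ n, IsMarkovKernel (Q n)] (n : ℕ) : IsMarkovKernel (step ε κ θstar sel hsel Q n) := by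
  unfold step
  infer_instance

/-- The law `P_{θ*}` of the trajectory `(Θ_t, S_{t+1}, Y_{t+1})`, `t ≥ 0`, of the algorithm started
at `Θ₀ = θinit`, with the posterior sampling kernels `Q n`, `n ≥ 1`. -/
def law {N : ℕ} (ε κ : ℝ) (θstar θinit : Simplex N) (sel : Simplex N → ProperSubset N)
    (hsel : Measurable sel) (Q : (n : ℕ) → Kernel (Data N n × Simplex N) (Simplex N))
    [∀ n, IsMarkovKernel (Q n)] : Measure (ℕ → Record N) :=
  Kernel.trajMeasure (X := fun _ => Record N) (observe ε κ θstar sel hsel θinit)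
    (step ε κ θstar sel hsel Q)

end AdOBEst

end

namespace AdOBEst

/-! ### The transition probabilities of the mechanism -/

/-! The proof bounds Hellinger affinities and takes a union bound over a net. For each fixed `S` the
response distribution determines `θ`, and there are finitely many `S`, so
`exists_mul_norm_sub_sq_le` has one constant for all of them. With `sum_h_mul_sqrt_div_le`, the
conditional mean of the square root of each likelihood factor is at most `exp (-δ‖θ - θstar‖²)`,
whatever the past. This uniformity survives the adaptive choice of subsets: conditioning one step at
a time (`lintegral_prod_trajMeasure_le`) bounds the mean root likelihood ratio after `n` steps by
`exp (-nδ‖θ - θstar‖²)`.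

Since `h` is bounded below, likelihoods at points `1/n` apart are comparable
(`exists_likelihood_le_mul`), so a net of polynomial size controls the ratio everywhere outside the
ball. The normalizing integral loses only a polynomial factor, because a `1/n`-cube about `θstar`
carries at least a proportion `n ^ (-N)` of the volume. With squared radius of order `n ^ (-a)`, the
exponent is of order `n ^ (1 - a)`, which beats every polynomial; Markov's inequality concludes. -/

theorem sum_toReal_pmf {α : Type*} [Fintype α] (p : PMF α) : ∑ a, (p a).toReal = 1 := by
  have := p.tsum_coe
  rw [tsum_fintype] at this
  rw [← ENNReal.toReal_sum fun a _ => p.apply_ne_top a, this, ENNReal.toReal_one]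

theorem toReal_pmf_bind {α β : Type*} [Fintype α] (p : PMF α) (f : α → PMF β) (b : β) :
    (p.bind f b).toReal = ∑ a, (p a).toReal * (f a b).toReal := by
  rw [PMF.bind_apply, tsum_fintype, ENNReal.toReal_sum fun a _ =>
    ENNReal.mul_ne_top (p.apply_ne_top a) ((f a).apply_ne_top b)]
  simp_rw [ENNReal.toReal_mul]

/-- Standard randomized response in terms of `p = exp e` and `m = |A| - 1`. -/
theorem toReal_srr {N : ℕ} {A : Finset (Fin (N + 1))} (e : ℝ) {x : Fin (N + 1)} (hx : x ∈ A)
    (y : Fin (N + 1)) :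
    (srr A e x y).toReal =
      if y ∈ A then (if y = x then Real.exp e else 1) / (Real.exp e + (A.card - 1 : ℕ)) else 0 := by
  have hp := Real.exp_pos e
  have hm : (0 : ℝ) ≤ (A.card - 1 : ℕ) := Nat.cast_nonneg _
  have hq : 1 - Real.exp e / (Real.exp e + (A.card - 1 : ℕ)) =
      (A.card - 1 : ℕ) / (Real.exp e + (A.card - 1 : ℕ)) := by
    field_simp; ring
  have h2 : 0 ≤ Real.exp e / (Real.exp e + (A.card - 1 : ℕ)) := by positivity
  have h3 : 0 ≤ ((A.card - 1 : ℕ) : ℝ) / (Real.exp e + (A.card - 1 : ℕ)) := by positivity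
  have hc : (A.erase x).card = A.card - 1 := Finset.card_erase_of_mem hx
  unfold srr
  rw [toReal_pmf_bind, Fintype.sum_bool]
  simp only [coin, PMF.ofFintype_apply, cond_true, cond_false, if_true, Bool.false_eq_true,
    if_false, hq, ENNReal.toReal_ofReal h2, ENNReal.toReal_ofReal h3]
  by_cases hA : (A.erase x).Nonempty
  · have hpos : (0 : ℝ) < (A.card - 1 : ℕ) := by
      rw [← hc]; exact_mod_cast hA.card_pos
    rw [dif_pos hA]
    by_cases hyx : y = x
    · subst hyx
      simp [PMF.uniformOfFinset_apply, hx]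
    · by_cases hy : y ∈ A
      · simp only [PMF.pure_apply, hyx, if_false, PMF.uniformOfFinset_apply, Finset.mem_erase, hy,
          and_true, ne_eq, not_false_eq_true, if_true, hc]
        simp only [ENNReal.toReal_zero, mul_zero, zero_add, ENNReal.toReal_inv,
          ENNReal.toReal_natCast]
        field_simp
      · simp [PMF.uniformOfFinset_apply, hyx, hy]
  -- Here `A = {x}`: the coin shows `true` almost surely, so the fallback branch has no weight.
  · have h0 : A.card - 1 = 0 := by
      rw [← hc, Finset.not_nonempty_iff_eq_empty.1 hA, Finset.card_empty]
    have hmem : y ∈ A ↔ y = x := by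
      refine ⟨fun hy => ?_, fun h => h ▸ hx⟩
      by_contra hne
      exact hA ⟨y, Finset.mem_erase.2 ⟨hne, hy⟩⟩
    rw [dif_neg hA]
    by_cases hyx : y = x
    · simp [h0, hyx, hx]
    · simp [h0, hyx, hmem]

/-- The response probabilities on an input in `S`. -/
theorem g_of_mem {N : ℕ} (ε κ : ℝ) {S : ProperSubset N} {x : Fin (N + 1)} (hx : x ∈ S.1)
    (y : Fin (N + 1)) :
    g ε κ S y x = if y ∈ S.1 then (if y = x then Real.exp (κ * ε) else 1) /
        (Real.exp (κ * ε) + S.1.card)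
      else (S.1ᶜ.card : ℝ)⁻¹ * (1 / (Real.exp (κ * ε) + S.1.card)) := by
  have hpos : (0 : ℝ) < S.1ᶜ.card := by exact_mod_cast (compl_nonempty S).card_pos
  unfold g mechanism rrrr
  rw [if_pos hx, toReal_pmf_bind]
  have key : ∀ r, (PMF.uniformOfFinset S.1ᶜ (compl_nonempty S) r).toReal *
      (srr (insert r S.1) (κ * ε) x y).toReal = if r ∈ S.1ᶜ then (S.1ᶜ.card : ℝ)⁻¹ *
        (if y ∈ insert r S.1 then (if y = x then Real.exp (κ * ε) else 1) /
        (Real.exp (κ * ε) + S.1.card) else 0) else 0 := by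
    intro r
    rw [toReal_srr _ (Finset.mem_insert_of_mem hx),
      PMF.uniformOfFinset_apply]
    split_ifs with hr <;> simp_all
  simp_rw [key]
  rw [← Finset.sum_filter, Finset.filter_mem_eq_inter, Finset.univ_inter]
  -- A response in `S` gets the same contribution from every `r`; a response outside `S` is possible
  -- only if `r = y`.
  by_cases hy : y ∈ S.1
  · simp only [Finset.mem_insert, hy, or_true, if_true, Finset.sum_const, nsmul_eq_mul]
    field_simp
  · have hyx : y ≠ x := fun h => hy (h ▸ hx)
    simp only [Finset.mem_insert, hy, or_false, if_false, hyx]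
    rw [← Finset.mul_sum, Finset.sum_ite_eq, if_pos (Finset.mem_compl.2 hy)]

/-- The response probabilities on an input outside `S`. -/
theorem g_of_notMem {N : ℕ} (ε κ : ℝ) {S : ProperSubset N} {x : Fin (N + 1)} (hx : x ∉ S.1)
    (y : Fin (N + 1)) :
    g ε κ S y x = if y ∈ S.1 then 1 / (Real.exp (κ * ε) + S.1.card)
      else (if y = x then Real.exp (eps₂ ε (κ * ε) S) else 1) /
        (Real.exp (eps₂ ε (κ * ε) S) + (S.1ᶜ.card - 1 : ℕ)) *
        (Real.exp (κ * ε) / (Real.exp (κ * ε) + S.1.card)) := by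
  have hxc : x ∈ S.1ᶜ := Finset.mem_compl.2 hx
  unfold g mechanism rrrr
  rw [if_neg hx, toReal_pmf_bind]
  set e₂ := eps₂ ε (κ * ε) S
  have hw : ∑ r, (srr S.1ᶜ e₂ x r).toReal = 1 := sum_toReal_pmf _
  have key : ∀ r, (srr S.1ᶜ e₂ x r).toReal * (srr (insert r S.1) (κ * ε) r y).toReal =
      (srr S.1ᶜ e₂ x r).toReal * if y ∈ S.1 then 1 / (Real.exp (κ * ε) + S.1.card)
        else if y = r then Real.exp (κ * ε) / (Real.exp (κ * ε) + S.1.card) else 0 := by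
    intro r
    -- For `r ∈ S` the claimed formula for the outer response is not the true one, but such `r` have
    -- weight zero.
    by_cases hr : r ∈ S.1
    · rw [toReal_srr _ hxc, if_neg (by simpa using hr)]; simp
    · rw [toReal_srr _ (Finset.mem_insert_self r S.1), Finset.card_insert_of_notMem hr]
      by_cases hy : y ∈ S.1
      · have : y ≠ r := fun h => hr (h ▸ hy)
        simp [hy, this]
      · by_cases hyr : y = r <;> simp [hy, hyr, hr]
  simp_rw [key]
  by_cases hy : y ∈ S.1
  · simp only [hy, if_true]
    rw [← Finset.sum_mul, hw, one_mul]
  · simp only [hy, if_false, mul_ite, mul_zero, Finset.sum_ite_eq, Finset.mem_univ, if_true]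
    rw [toReal_srr _ hxc, if_pos (Finset.mem_compl.2 hy)]

theorem g_pos {N : ℕ} (ε κ : ℝ) (S : ProperSubset N) (y x : Fin (N + 1)) : 0 < g ε κ S y x := by
  have hpos : (0 : ℝ) < S.1ᶜ.card := by exact_mod_cast (compl_nonempty S).card_pos
  by_cases hx : x ∈ S.1
  · rw [g_of_mem ε κ hx]
    split_ifs <;> positivity
  · rw [g_of_notMem ε κ hx]
    split_ifs <;> positivity

theorem sum_g {N : ℕ} (ε κ : ℝ) (S : ProperSubset N) (x : Fin (N + 1)) :
    ∑ y, g ε κ S y x = 1 :=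
  sum_toReal_pmf _

/-- In the first branch `exp (ε₁ - ε) * |Sᶜ| > 1`, so the denominator inside the logarithm is
positive; it is smaller than the numerator because `exp (ε₁ - ε) < 1`. Positivity is what makes the
response on `Sᶜ` informative. -/
theorem eps₂_pos {N : ℕ} {ε ε₁ : ℝ} (hε : 0 < ε) (hlt : ε₁ < ε) (S : ProperSubset N) :
    0 < eps₂ ε ε₁ S := by
  unfold eps₂
  split_ifs with hS
  · refine lt_min hε (Real.log_pos ?_)
    have hm : (0 : ℝ) < S.1ᶜ.card := by exact_mod_cast (compl_nonempty S).card_pos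
    have h1 : Real.exp (ε - ε₁) < S.1ᶜ.card := (Real.lt_log_iff_exp_lt hm).1 hS.1
    have h2 : 1 < Real.exp (ε₁ - ε) * S.1ᶜ.card := by
      calc (1 : ℝ) = Real.exp (ε₁ - ε) * Real.exp (ε - ε₁) := by rw [← Real.exp_add]; simp
        _ < _ := by gcongr
    have h3 : Real.exp (ε₁ - ε) < 1 := by simpa using hlt
    rw [one_lt_div (by linarith)]
    nlinarith
  · exact hε

/-- The response probabilities determine the input distribution. -/
theorem eq_zero_of_sum_g_mul_eq_zero {N : ℕ} {ε κ : ℝ} (hε : 0 < ε) (hκ₀ : 0 < κ) (hκ₁ : κ < 1)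
    (S : ProperSubset N) {v : Fin (N + 1) → ℝ} (hv : ∑ x, v x = 0)
    (h0 : ∀ y, ∑ x, g ε κ S y x * v x = 0) (x : Fin (N + 1)) : v x = 0 := by
  have he₁ : 1 < Real.exp (κ * ε) := Real.one_lt_exp_iff.2 (by positivity)
  have he₂ : 1 < Real.exp (eps₂ ε (κ * ε) S) :=
    Real.one_lt_exp_iff.2 (eps₂_pos hε (by nlinarith) S)
  have hS : ∀ y ∈ S.1, v y = 0 := by
    intro y hy
    set q := 1 / (Real.exp (κ * ε) + S.1.card)
    have hq : 0 < q := by positivity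
    -- As a function of the input, this row is a constant plus a spike at `y`. The constant is
    -- annihilated by `∑ v = 0`, leaving the spike.
    have hg : ∀ x, g ε κ S y x * v x =
        q * v x + if x = y then (Real.exp (κ * ε) - 1) * q * v x else 0 := by
      intro x
      by_cases hx : x ∈ S.1
      · rw [g_of_mem ε κ hx, if_pos hy]
        by_cases hxy : x = y
        · simp only [hxy, if_true, q]; ring
        · simp only [hxy, Ne.symm hxy, if_false, q]; ring
      · have hxy : x ≠ y := fun h => hx (h ▸ hy)
        rw [g_of_notMem ε κ hx, if_pos hy, if_neg hxy, add_zero]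
    have := h0 y
    simp_rw [hg] at this
    rw [Finset.sum_add_distrib, ← Finset.mul_sum, hv, Finset.sum_ite_eq',
      if_pos (Finset.mem_univ y), mul_zero, zero_add] at this
    have hne : (Real.exp (κ * ε) - 1) * q ≠ 0 := (mul_pos (by linarith) hq).ne'
    exact (mul_eq_zero.1 this).resolve_left hne
  by_cases hx : x ∈ S.1
  · exact hS x hx
  · set q := 1 / (Real.exp (eps₂ ε (κ * ε) S) + (S.1ᶜ.card - 1 : ℕ)) *
        (Real.exp (κ * ε) / (Real.exp (κ * ε) + S.1.card)) with hqd
    have hq : 0 < q := by positivity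
    -- This row is a constant plus a spike only on `Sᶜ`; on `S` its values are irrelevant since `v`
    -- already vanishes there.
    have hg : ∀ z, g ε κ S x z * v z =
        q * v z + if z = x then (Real.exp (eps₂ ε (κ * ε) S) - 1) * q * v z else 0 := by
      intro z
      by_cases hz : z ∈ S.1
      · simp [hS z hz]
      · rw [g_of_notMem ε κ hz, if_neg hx]
        by_cases hzx : z = x
        · simp only [hzx, if_true, hqd]; ring
        · simp only [hzx, Ne.symm hzx, if_false, hqd]; ring
    have := h0 x
    simp_rw [hg] at this
    rw [Finset.sum_add_distrib, ← Finset.mul_sum, hv, Finset.sum_ite_eq',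
      if_pos (Finset.mem_univ x), mul_zero, zero_add] at this
    have hne : (Real.exp (eps₂ ε (κ * ε) S) - 1) * q ≠ 0 := (mul_pos (by linarith) hq).ne'
    exact (mul_eq_zero.1 this).resolve_left hne

/-! ### The response probabilities as functions of the parameter -/

theorem toReal_responseLaw {N : ℕ} (ε κ : ℝ) (θ : Simplex N) (S : ProperSubset N)
    (y : Fin (N + 1)) : (responseLaw ε κ θ S y).toReal = h ε κ S y θ := by
  unfold responseLaw h
  rw [toReal_pmf_bind]
  refine Finset.sum_congr rfl fun x _ => ?_
  rw [cat, PMF.ofFintype_apply, ENNReal.toReal_ofReal (θ.2.2 x), mul_comm]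
  rfl

theorem sum_h {N : ℕ} (ε κ : ℝ) (S : ProperSubset N) (θ : Simplex N) :
    ∑ y, h ε κ S y θ = 1 := by
  simp_rw [← toReal_responseLaw]
  exact sum_toReal_pmf _

/-- `h` is a convex combination of entries of `g`, of which there are finitely many, all positive.
-/
theorem exists_le_h (N : ℕ) (ε κ : ℝ) :
    ∃ b > 0, ∀ (S : ProperSubset N) (y : Fin (N + 1)) (θ : Simplex N), b ≤ h ε κ S y θ := by
  have : Nonempty (ProperSubset N) := ⟨⟨∅, Finset.univ_nonempty.ne_empty.symm⟩⟩
  obtain ⟨i, hi⟩ := Finite.exists_min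
    fun i : ProperSubset N × Fin (N + 1) × Fin (N + 1) => g ε κ i.1 i.2.1 i.2.2
  refine ⟨_, g_pos ε κ i.1 i.2.1 i.2.2, fun S y θ => ?_⟩
  calc g ε κ i.1 i.2.1 i.2.2 = ∑ x, g ε κ i.1 i.2.1 i.2.2 * θ.1 x := by
        rw [← Finset.mul_sum, θ.2.1, mul_one]
    _ ≤ _ := Finset.sum_le_sum fun x _ =>
        mul_le_mul_of_nonneg_right (hi (S, y, x)) (θ.2.2 x)

theorem h_pos {N : ℕ} (ε κ : ℝ) (S : ProperSubset N) (y : Fin (N + 1)) (θ : Simplex N) :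
    0 < h ε κ S y θ := by
  obtain ⟨b, hb, hle⟩ := exists_le_h N ε κ
  exact hb.trans_le (hle S y θ)

theorem g_le_one {N : ℕ} (ε κ : ℝ) (S : ProperSubset N) (y x : Fin (N + 1)) :
    g ε κ S y x ≤ 1 := by
  rw [← sum_g ε κ S x]
  exact Finset.single_le_sum (f := fun y => g ε κ S y x) (fun y _ => (g_pos ε κ S y x).le)
    (Finset.mem_univ y)

theorem h_le_one {N : ℕ} (ε κ : ℝ) (S : ProperSubset N) (y : Fin (N + 1)) (θ : Simplex N) :
    h ε κ S y θ ≤ 1 := by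
  rw [← sum_h ε κ S θ]
  exact Finset.single_le_sum (f := fun y => h ε κ S y θ) (fun y _ => (h_pos ε κ S y θ).le)
    (Finset.mem_univ y)

theorem h_sub_h {N : ℕ} (ε κ : ℝ) (S : ProperSubset N) (y : Fin (N + 1)) (θ θ' : Simplex N) :
    h ε κ S y θ - h ε κ S y θ' = ∑ x, g ε κ S y x * (θ.1 - θ'.1) x := by
  simp only [h, PiLp.sub_apply, mul_sub, Finset.sum_sub_distrib]

theorem h_sub_h_le {N : ℕ} (ε κ : ℝ) (S : ProperSubset N) (y : Fin (N + 1)) {θ θ' : Simplex N}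
    {r : ℝ} (hr : ∀ x, |θ.1 x - θ'.1 x| ≤ r) :
    h ε κ S y θ - h ε κ S y θ' ≤ (N + 1) * r := by
  rw [h_sub_h]
  calc ∑ x, g ε κ S y x * (θ.1 - θ'.1) x ≤ ∑ _x : Fin (N + 1), r := by
        refine Finset.sum_le_sum fun x _ => ?_
        calc g ε κ S y x * (θ.1 - θ'.1) x ≤ g ε κ S y x * |θ.1 x - θ'.1 x| :=
              mul_le_mul_of_nonneg_left (le_abs_self _) (g_pos ε κ S y x).le
          _ ≤ 1 * |θ.1 x - θ'.1 x| := by gcongr; exact g_le_one ε κ S y x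
          _ ≤ r := by rw [one_mul]; exact hr x
    _ = (N + 1) * r := by simp

/-- Quantitative identifiability of the parameter, uniformly over the subset. -/
theorem exists_mul_norm_sub_sq_le {N : ℕ} {ε κ : ℝ} (hε : 0 < ε) (hκ₀ : 0 < κ) (hκ₁ : κ < 1) :
    ∃ m > 0, ∀ (S : ProperSubset N) (θ θ' : Simplex N),
      m * ‖θ.1 - θ'.1‖ ^ 2 ≤ ∑ y, (h ε κ S y θ - h ε κ S y θ') ^ 2 := by
  have : Nonempty (ProperSubset N) := ⟨⟨∅, Finset.univ_nonempty.ne_empty.symm⟩⟩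
  have key : ∀ S : ProperSubset N, ∃ m > 0, ∀ θ θ' : Simplex N,
      m * ‖θ.1 - θ'.1‖ ^ 2 ≤ ∑ y, (h ε κ S y θ - h ε κ S y θ') ^ 2 := by
    intro S
    -- The extra component `∑ v` makes `T` injective on the whole space. It vanishes on differences
    -- of probability vectors, so only the response component counts.
    let T : EuclideanSpace ℝ (Fin (N + 1)) →ₗ[ℝ] (Fin (N + 1) → ℝ) × ℝ :=
      { toFun := fun v => (fun y => ∑ x, g ε κ S y x * v x, ∑ x, v x)
        map_add' := fun v w => by
          ext <;> simp [mul_add, Finset.sum_add_distrib]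
        map_smul' := fun c v => by
          ext <;> simp [Finset.mul_sum, mul_left_comm] }
    have hT : LinearMap.ker T = ⊥ := by
      rw [LinearMap.ker_eq_bot']
      intro v hv
      ext x
      exact eq_zero_of_sum_g_mul_eq_zero hε hκ₀ hκ₁ S (v := v) (congrArg Prod.snd hv)
        (fun y => congrFun (congrArg Prod.fst hv) y) x
    obtain ⟨C, hC, hanti⟩ := T.exists_antilipschitzWith hT
    have hC' : (0 : ℝ) < C := hC
    refine ⟨(C ^ 2 : ℝ)⁻¹, by positivity, fun θ θ' => ?_⟩
    rw [inv_mul_le_iff₀ (by positivity)]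
    have h1 : ‖θ.1 - θ'.1‖ ≤ C * ‖T (θ.1 - θ'.1)‖ := by
      simpa using hanti.le_mul_dist (θ.1 - θ'.1) 0
    have h2 : ‖T (θ.1 - θ'.1)‖ ≤ √(∑ y, (h ε κ S y θ - h ε κ S y θ') ^ 2) := by
      have hs : (T (θ.1 - θ'.1)).2 = 0 := by
        simp [T, θ.2.1, θ'.2.1]
      rw [Prod.norm_def, hs, norm_zero, max_eq_left (norm_nonneg _),
        pi_norm_le_iff_of_nonneg (Real.sqrt_nonneg _)]
      intro y
      have : (T (θ.1 - θ'.1)).1 y = h ε κ S y θ - h ε κ S y θ' := (h_sub_h ε κ S y θ θ').symm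
      rw [this, Real.norm_eq_abs]
      refine Real.abs_le_sqrt ?_
      exact Finset.single_le_sum (f := fun y => (h ε κ S y θ - h ε κ S y θ') ^ 2)
        (fun y _ => sq_nonneg _) (Finset.mem_univ y)
    calc ‖θ.1 - θ'.1‖ ^ 2 ≤ (C * √(∑ y, (h ε κ S y θ - h ε κ S y θ') ^ 2)) ^ 2 := by
          gcongr; exact h1.trans (by gcongr)
      _ = _ := by rw [mul_pow, Real.sq_sqrt (Finset.sum_nonneg fun y _ => sq_nonneg _)]
  choose m hm hle using key
  obtain ⟨S₀, hS₀⟩ := Finite.exists_min m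
  exact ⟨m S₀, hm S₀, fun S θ θ' =>
    (mul_le_mul_of_nonneg_right (hS₀ S) (sq_nonneg _)).trans (hle S θ θ')⟩

/-- The Hellinger affinity of two response distributions. -/
theorem sum_h_mul_sqrt_div_le {N : ℕ} (ε κ : ℝ) (S : ProperSubset N) (θ θ' : Simplex N) :
    ∑ y, h ε κ S y θ' * √(h ε κ S y θ / h ε κ S y θ') ≤
      1 - (∑ y, (h ε κ S y θ - h ε κ S y θ') ^ 2) / 8 := by
  have key : ∀ y, h ε κ S y θ' * √(h ε κ S y θ / h ε κ S y θ') ≤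
      (h ε κ S y θ + h ε κ S y θ') / 2 - (h ε κ S y θ - h ε κ S y θ') ^ 2 / 8 := by
    intro y
    have ha := h_pos ε κ S y θ
    have hb := h_pos ε κ S y θ'
    have ha1 := h_le_one ε κ S y θ
    have hb1 := h_le_one ε κ S y θ'
    generalize h ε κ S y θ = a at *
    generalize h ε κ S y θ' = b at *
    obtain ⟨s, hs, rfl⟩ : ∃ s > 0, s ^ 2 = a := ⟨√a, Real.sqrt_pos.2 ha, Real.sq_sqrt ha.le⟩
    obtain ⟨t, ht, rfl⟩ : ∃ t > 0, t ^ 2 = b := ⟨√b, Real.sqrt_pos.2 hb, Real.sq_sqrt hb.le⟩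
    have h1 : √(s ^ 2 / t ^ 2) = s / t := by rw [← div_pow, Real.sqrt_sq (by positivity)]
    have h2 : t ^ 2 * (s / t) = s * t := by field_simp
    have hs1 : s ≤ 1 := by nlinarith
    have ht1 : t ≤ 1 := by nlinarith
    -- The gap `(s² + t²)/2 - st` equals `(s - t)²/2`, while `(s² - t²)² = (s - t)²(s + t)² ≤ 4(s -
    -- t)²`; hence the factor `1/8`.
    have h3 : (s + t) ^ 2 ≤ 4 := by nlinarith
    rw [h1, h2]
    nlinarith [mul_le_mul_of_nonneg_left h3 (sq_nonneg (s - t))]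
  calc _ ≤ ∑ y, ((h ε κ S y θ + h ε κ S y θ') / 2 - (h ε κ S y θ - h ε κ S y θ') ^ 2 / 8) :=
        Finset.sum_le_sum fun y _ => key y
    _ = _ := by
        rw [Finset.sum_sub_distrib, ← Finset.sum_div, ← Finset.sum_div, Finset.sum_add_distrib,
          sum_h, sum_h]
        ring

/-- The likelihood of the data. -/
noncomputable def likelihood {N n : ℕ} (ε κ : ℝ) (D : Data N n) (θ : Simplex N) : ℝ :=
  ∏ t, h ε κ (D t).1 (D t).2 θ

theorem likelihood_pos {N n : ℕ} (ε κ : ℝ) (D : Data N n) (θ : Simplex N) :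
    0 < likelihood ε κ D θ :=
  Finset.prod_pos fun _ _ => h_pos ε κ _ _ θ

theorem likelihood_le_one {N n : ℕ} (ε κ : ℝ) (D : Data N n) (θ : Simplex N) :
    likelihood ε κ D θ ≤ 1 :=
  Finset.prod_le_one (fun _ _ => (h_pos ε κ _ _ θ).le) fun _ _ => h_le_one ε κ _ _ θ

theorem continuous_likelihood {N n : ℕ} (ε κ : ℝ) (D : Data N n) :
    Continuous (likelihood ε κ D) := by
  unfold likelihood h
  fun_prop

/-- Parameters at distance `1 / n` have comparable likelihoods for `n` observations. -/
theorem exists_likelihood_le_mul (N : ℕ) (ε κ : ℝ) :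
    ∃ L > 0, ∀ (n : ℕ) (D : Data N n) (θ θ' : Simplex N),
      (∀ x, |θ.1 x - θ'.1 x| ≤ 1 / n) → likelihood ε κ D θ ≤ L * likelihood ε κ D θ' := by
  obtain ⟨b, hb, hle⟩ := exists_le_h N ε κ
  -- Each factor changes by at most `(N + 1)/n`, which is at most `(N + 1)/(b n)` times its value
  -- since `b ≤ h`. Over `n` factors this compounds to `exp ((N + 1)/b)`.
  refine ⟨Real.exp ((N + 1) / b), Real.exp_pos _, fun n D θ θ' hr => ?_⟩
  rcases Nat.eq_zero_or_pos n with rfl | hn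
  · simp only [likelihood, Finset.univ_eq_empty, Finset.prod_empty, mul_one, Real.one_le_exp_iff]
    positivity
  have hn' : (0 : ℝ) < n := by exact_mod_cast hn
  calc likelihood ε κ D θ
      ≤ ∏ t, Real.exp ((N + 1) / b / n) * h ε κ (D t).1 (D t).2 θ' := by
        refine Finset.prod_le_prod (fun t _ => (h_pos ε κ _ _ θ).le) fun t _ => ?_
        have h1 := h_sub_h_le ε κ (D t).1 (D t).2 hr
        have h2 := hle (D t).1 (D t).2 θ'
        have h3 := Real.add_one_le_exp ((N + 1 : ℝ) / b / n)
        have h4 : (N + 1 : ℝ) * (1 / n) ≤ (N + 1) / b / n * h ε κ (D t).1 (D t).2 θ' := by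
          calc (N + 1 : ℝ) * (1 / n) = (N + 1) / b / n * b := by field_simp
            _ ≤ _ := by gcongr
        nlinarith
    _ = _ := by
        rw [Finset.prod_mul_distrib, Finset.prod_const, Finset.card_univ, Fintype.card_fin,
          ← Real.exp_nat_mul, likelihood]
        congr 2
        field_simp

/-! ### Likelihood ratios along trajectories -/

theorem map_eval_zero_trajMeasure {X : ℕ → Type*} [∀ n, MeasurableSpace (X n)]
    (μ₀ : Measure (X 0)) (κ : (n : ℕ) → Kernel ((i : Finset.Iic n) → X i) (X (n + 1)))
    [∀ n, IsMarkovKernel (κ n)] :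
    (Kernel.trajMeasure μ₀ κ).map (fun ω => ω 0) = μ₀ := by
  have h1 : (Kernel.trajMeasure μ₀ κ).map (Preorder.frestrictLe 0) =
      μ₀.map (MeasurableEquiv.piUnique (fun i : Finset.Iic 0 => X i)).symm := by
    rw [Kernel.trajMeasure, Measure.map_comp _ _ (by fun_prop), Kernel.traj_map_frestrictLe,
      Kernel.partialTraj_self, Measure.id_comp]
    rfl
  have h2 := Measure.map_map (μ := Kernel.trajMeasure μ₀ κ)
    (MeasurableEquiv.piUnique (fun i : Finset.Iic 0 => X i)).measurable
    (Preorder.measurable_frestrictLe 0)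
  rw [h1] at h2
  exact h2.symm.trans (MeasurableEquiv.map_map_symm _)

/-- Tower property: the one-step bound holds for every past, so integrating out the last coordinate
yields a factor `ρ`. No independence is needed. -/
theorem lintegral_prod_trajMeasure_le {X : ℕ → Type*} [∀ n, MeasurableSpace (X n)]
    (μ₀ : Measure (X 0)) [IsProbabilityMeasure μ₀]
    (κ : (n : ℕ) → Kernel ((i : Finset.Iic n) → X i) (X (n + 1))) [∀ n, IsMarkovKernel (κ n)]
    (f : (n : ℕ) → X n → ENNReal) (hf : ∀ n, Measurable (f n)) (ρ : ENNReal)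
    (h0 : ∫⁻ x, f 0 x ∂μ₀ ≤ ρ) (hκ : ∀ n r, ∫⁻ x, f (n + 1) x ∂(κ n r) ≤ ρ) (n : ℕ) :
    ∫⁻ ω, ∏ i ∈ Finset.range n, f i (ω i) ∂(Kernel.trajMeasure μ₀ κ) ≤ ρ ^ n := by
  -- The induction starts from one factor, since coordinate `0` is governed by `μ₀` and not by a
  -- transition kernel.
  rcases n with _ | n
  · simp
  induction n with
  | zero =>
    simp only [zero_add, Finset.prod_range_one, pow_one]
    rw [← lintegral_map (hf 0) (by fun_prop), map_eval_zero_trajMeasure]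
    exact h0
  | succ n ih =>
    let G : ((i : Finset.Iic n) → X i) → ENNReal := fun r => ∏ i : Finset.Iic n, f i (r i)
    have hG : Measurable G := Finset.measurable_fun_prod _ fun i _ =>
      (hf i).comp (measurable_pi_apply i)
    have hGω : ∀ ω : (n : ℕ) → X n,
        ∏ i ∈ Finset.range (n + 1), f i (ω i) = G (Preorder.frestrictLe n ω) := by
      intro ω
      rw [Nat.range_succ_eq_Iic, ← Finset.prod_coe_sort]
      rfl
    simp_rw [hGω] at ih
    simp_rw [Finset.prod_range_succ _ (n + 1), hGω]
    have hmeas : Measurable fun p : ((i : Finset.Iic n) → X i) × X (n + 1) =>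
        G p.1 * f (n + 1) p.2 := by fun_prop
    calc ∫⁻ ω, G (Preorder.frestrictLe n ω) * f (n + 1) (ω (n + 1)) ∂(Kernel.trajMeasure μ₀ κ)
        = ∫⁻ p, G p.1 * f (n + 1) p.2 ∂((Kernel.trajMeasure μ₀ κ).map
            fun ω => (Preorder.frestrictLe n ω, ω (n + 1))) := by
          rw [lintegral_map hmeas (by fun_prop)]
      _ = ∫⁻ r, ∫⁻ x, G r * f (n + 1) x ∂(κ n r)
            ∂((Kernel.trajMeasure μ₀ κ).map (Preorder.frestrictLe n)) := by
          rw [← Kernel.map_frestrictLe_trajMeasure_compProd_eq_map_trajMeasure,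
            Measure.lintegral_compProd hmeas]
      _ ≤ ∫⁻ r, G r * ρ ∂((Kernel.trajMeasure μ₀ κ).map (Preorder.frestrictLe n)) := by
          refine lintegral_mono fun r => ?_
          rw [lintegral_const_mul _ (hf _)]
          gcongr
          exact hκ n r
      _ = (∫⁻ ω, G (Preorder.frestrictLe n ω) ∂(Kernel.trajMeasure μ₀ κ)) * ρ := by
          rw [lintegral_mul_const _ hG, lintegral_map hG (by fun_prop)]
      _ ≤ ρ ^ (n + 1) * ρ := by gcongr
      _ = _ := (pow_succ _ _).symm

theorem lintegral_observe {N : ℕ} (ε κ : ℝ) (θstar : Simplex N)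
    (sel : Simplex N → ProperSubset N) (hsel : Measurable sel)
    (f : ProperSubset N × Fin (N + 1) → ENNReal) (θ : Simplex N) :
    ∫⁻ r, f r.2 ∂(observe ε κ θstar sel hsel θ) =
      ∑ y, responseLaw ε κ θstar (sel θ) y * f (sel θ, y) := by
  have : IsMarkovKernel (Kernel.ofFunOfCountable fun S : ProperSubset N =>
      (responseLaw ε κ θstar S).toMeasure) := ⟨fun S => by
    change IsProbabilityMeasure (responseLaw ε κ θstar S).toMeasure
    infer_instance⟩
  have hf : Measurable f := measurable_of_countable f
  unfold observe
  rw [Kernel.lintegral_prod _ _ _ (by fun_prop : Measurable fun r : Record N => f r.2),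
    Kernel.lintegral_deterministic' _ (by fun_prop)]
  rw [Kernel.lintegral_compProd _ _ _ hf,
    Kernel.lintegral_deterministic' _ (measurable_of_countable _)]
  simp only [Kernel.prodMkLeft_apply]
  change ∫⁻ y, f (sel θ, y) ∂(responseLaw ε κ θstar (sel θ)).toMeasure = _
  rw [lintegral_fintype]
  refine Finset.sum_congr rfl fun y _ => ?_
  rw [PMF.toMeasure_apply_singleton _ _ (measurableSet_singleton y), mul_comm]

/-- The expected product, along the trajectory, of functions of the observations. -/
theorem lintegral_prod_law_le {N : ℕ} (ε κ : ℝ) (θstar θinit : Simplex N)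
    (sel : Simplex N → ProperSubset N) (hsel : Measurable sel)
    (Q : (n : ℕ) → Kernel (Data N n × Simplex N) (Simplex N)) [∀ n, IsMarkovKernel (Q n)]
    (f : ProperSubset N × Fin (N + 1) → ENNReal) (ρ : ENNReal)
    (hρ : ∀ S, ∑ y, responseLaw ε κ θstar S y * f (S, y) ≤ ρ) (n : ℕ) :
    ∫⁻ ω, ∏ i, f (data n ω i) ∂(law ε κ θstar θinit sel hsel Q) ≤ ρ ^ n := by
  have hf : Measurable f := measurable_of_countable f
  have hobs : ∀ θ, ∫⁻ r, f r.2 ∂(observe ε κ θstar sel hsel θ) ≤ ρ := fun θ => by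
    rw [lintegral_observe]
    exact hρ _
  have hprod : ∀ ω : ℕ → Record N,
      ∏ i, f (data n ω i) = ∏ i ∈ Finset.range n, f (ω i).2 := fun ω =>
    Fin.prod_univ_eq_prod_range (fun i => f (ω i).2) n
  simp_rw [hprod]
  refine lintegral_prod_trajMeasure_le (X := fun _ => Record N) _ _ (fun _ r => f r.2)
    (fun _ => hf.comp measurable_snd) ρ (hobs θinit) (fun n r => ?_) n
  -- The one-step bound holds at every parameter, so averaging over the draw from `Q` preserves it.
  unfold step
  rw [Kernel.lintegral_comp _ _ _ (by fun_prop : Measurable fun r : Record N => f r.2)]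
  calc _ ≤ ∫⁻ _, ρ ∂((Q (n + 1)).comap (history n) (measurable_history n) r) :=
        lintegral_mono fun θ => hobs θ
    _ = ρ := by simp

/-- The square root of the likelihood ratio decays exponentially in the mean. -/
theorem exists_lintegral_sqrt_likelihood_div_le {N : ℕ} {ε κ : ℝ} (hε : 0 < ε) (hκ₀ : 0 < κ)
    (hκ₁ : κ < 1) :
    ∃ δ > 0, ∀ (θstar θinit : Simplex N) (sel : Simplex N → ProperSubset N) (hsel : Measurable sel)
      (Q : (n : ℕ) → Kernel (Data N n × Simplex N) (Simplex N)) [∀ n, IsMarkovKernel (Q n)]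
      (θ : Simplex N) (n : ℕ),
      ∫⁻ ω, ENNReal.ofReal √(likelihood ε κ (data n ω) θ / likelihood ε κ (data n ω) θstar)
        ∂(law ε κ θstar θinit sel hsel Q) ≤
      ENNReal.ofReal (Real.exp (-(n * (δ * ‖θ.1 - θstar.1‖ ^ 2)))) := by
  obtain ⟨m, hm, hle⟩ := exists_mul_norm_sub_sq_le (N := N) hε hκ₀ hκ₁
  -- The affinity is at most `1 - (m/8)‖θ - θstar‖²`, and `1 - u ≤ exp (-u)`.
  refine ⟨m / 8, by positivity, fun θstar θinit sel hsel Q _ θ n => ?_⟩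
  let f : ProperSubset N × Fin (N + 1) → ENNReal := fun p =>
    ENNReal.ofReal √(h ε κ p.1 p.2 θ / h ε κ p.1 p.2 θstar)
  have hprod : ∀ D : Data N n,
      ENNReal.ofReal √(likelihood ε κ D θ / likelihood ε κ D θstar) = ∏ i, f (D i) := by
    intro D
    simp only [likelihood, f]
    rw [← Finset.prod_div_distrib, Real.sqrt_prod _ fun i _ =>
      (div_pos (h_pos ε κ _ _ θ) (h_pos ε κ _ _ θstar)).le,
      ENNReal.ofReal_prod_of_nonneg fun i _ => Real.sqrt_nonneg _]
  have hρ : ∀ S, ∑ y, responseLaw ε κ θstar S y * f (S, y) ≤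
      ENNReal.ofReal (Real.exp (-(m / 8 * ‖θ.1 - θstar.1‖ ^ 2))) := by
    intro S
    have : ∀ y, responseLaw ε κ θstar S y * f (S, y) = ENNReal.ofReal
        (h ε κ S y θstar * √(h ε κ S y θ / h ε κ S y θstar)) := by
      intro y
      rw [ENNReal.ofReal_mul (h_pos ε κ S y θstar).le, ← toReal_responseLaw,
        ENNReal.ofReal_toReal (PMF.apply_ne_top _ _), toReal_responseLaw]
    simp_rw [this]
    rw [← ENNReal.ofReal_sum_of_nonneg fun y _ =>
      mul_nonneg (h_pos ε κ S y θstar).le (Real.sqrt_nonneg _)]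
    refine ENNReal.ofReal_le_ofReal ((sum_h_mul_sqrt_div_le ε κ S θ θstar).trans ?_)
    have h1 := hle S θ θstar
    have h2 := Real.add_one_le_exp (-(m / 8 * ‖θ.1 - θstar.1‖ ^ 2))
    linarith
  simp_rw [hprod]
  refine (lintegral_prod_law_le ε κ θstar θinit sel hsel Q f _ hρ n).trans_eq ?_
  rw [← ENNReal.ofReal_pow (Real.exp_pos _).le, ← Real.exp_nat_mul]
  congr 2
  ring

/-! ### The reference measure on the simplex -/

theorem apply_le_one {N : ℕ} (θ : Simplex N) (x : Fin (N + 1)) : θ.1 x ≤ 1 :=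
  (Finset.single_le_sum (f := fun x => θ.1 x) (fun x _ => θ.2.2 x) (Finset.mem_univ x)).trans_eq
    θ.2.1

theorem continuous_freeCoords {N : ℕ} : Continuous (freeCoords (N := N)) := by
  unfold freeCoords
  fun_prop

theorem freeCoords_injective {N : ℕ} : Function.Injective (freeCoords (N := N)) := by
  intro θ θ' hθ
  have hc : ∀ i : Fin N, θ.1 i.castSucc = θ'.1 i.castSucc := fun i => congrFun hθ i
  have h1 := θ.2.1
  have h2 := θ'.2.1
  rw [Fin.sum_univ_castSucc] at h1 h2
  simp_rw [hc] at h1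
  ext x
  induction x using Fin.lastCases with
  | last => linarith
  | cast i => exact hc i

/-- The simplex is closed, hence Polish, and a continuous injection from a Polish space is a
measurable embedding. This lets the comap measure be computed on images. -/
theorem measurableEmbedding_freeCoords {N : ℕ} : MeasurableEmbedding (freeCoords (N := N)) := by
  have hc : IsClosed {θ : EuclideanSpace ℝ (Fin (N + 1)) | (∑ k, θ k = 1) ∧ ∀ k, 0 ≤ θ k} := by
    have h1 : IsClosed {θ : EuclideanSpace ℝ (Fin (N + 1)) | ∑ k, θ k = 1} :=
      isClosed_eq (by fun_prop) (by fun_prop)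
    have h2 : IsClosed {θ : EuclideanSpace ℝ (Fin (N + 1)) | ∀ k, 0 ≤ θ k} := by
      rw [Set.ofPred_forall]
      exact isClosed_iInter fun k => isClosed_le (by fun_prop) (by fun_prop)
    exact h1.inter h2
  have : PolishSpace (Simplex N) := hc.polishSpace
  exact continuous_freeCoords.measurableEmbedding freeCoords_injective

theorem lebesgueSimplex_apply {N : ℕ} (A : Set (Simplex N)) :
    lebesgueSimplex N A = volume (freeCoords '' A) :=
  measurableEmbedding_freeCoords.comap_apply _ _

instance {N : ℕ} : IsFiniteMeasure (lebesgueSimplex N) := by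
  refine ⟨?_⟩
  rw [lebesgueSimplex_apply]
  refine lt_of_le_of_lt (measure_mono (t := Set.Icc 0 1) ?_) isCompact_Icc.measure_lt_top
  rintro _ ⟨θ, -, rfl⟩
  exact ⟨fun i => θ.2.2 _, fun i => apply_le_one θ _⟩

/-- Small neighbourhoods of a point carry a proportion `r ^ N` of the volume: they contain a
shrunk copy of the simplex. -/
theorem pow_mul_measure_univ_le {N : ℕ} (θ₀ : Simplex N) {r : ℝ} (hr₀ : 0 ≤ r) (hr₁ : r ≤ 1) :
    r ^ N * (lebesgueSimplex N).real Set.univ ≤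
      (lebesgueSimplex N).real {θ | ∀ x, |θ.1 x - θ₀.1 x| ≤ r} := by
  -- By convexity the homothety of ratio `r` about `θ₀` keeps the simplex inside itself. It lands
  -- within `r` of `θ₀` because coordinates differ by at most `1`, and it scales `N`-dimensional
  -- volume by `r ^ N`.
  have hsub : AffineMap.homothety (freeCoords θ₀) r '' (freeCoords '' Set.univ) ⊆
      freeCoords '' {θ : Simplex N | ∀ x, |θ.1 x - θ₀.1 x| ≤ r} := by
    rintro _ ⟨_, ⟨φ, -, rfl⟩, rfl⟩
    refine ⟨⟨(1 - r) • θ₀.1 + r • φ.1, ?_, fun k => ?_⟩, fun x => ?_, ?_⟩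
    · simp [Finset.sum_add_distrib, ← Finset.mul_sum, θ₀.2.1, φ.2.1]
    · have := mul_nonneg (sub_nonneg.2 hr₁) (θ₀.2.2 k)
      have := mul_nonneg hr₀ (φ.2.2 k)
      simp only [PiLp.add_apply, PiLp.smul_apply, smul_eq_mul]
      linarith
    · have h1 : ((1 - r) • θ₀.1 + r • φ.1) x - θ₀.1 x = r * (φ.1 x - θ₀.1 x) := by
        simp only [PiLp.add_apply, PiLp.smul_apply, smul_eq_mul]; ring
      rw [h1, abs_mul, abs_of_nonneg hr₀]
      refine mul_le_of_le_one_right hr₀ (abs_le.2 ⟨?_, ?_⟩) <;>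
        linarith [θ₀.2.2 x, φ.2.2 x, apply_le_one θ₀ x, apply_le_one φ x]
    · ext i
      simp only [freeCoords, AffineMap.homothety_apply, vsub_eq_sub, vadd_eq_add, Pi.add_apply,
        Pi.smul_apply, Pi.sub_apply, smul_eq_mul, PiLp.add_apply, PiLp.smul_apply]
      ring
  have hle := measure_mono (μ := volume) hsub
  rw [Measure.addHaar_image_homothety, ← lebesgueSimplex_apply, ← lebesgueSimplex_apply,
    Module.finrank_fin_fun, abs_of_nonneg (pow_nonneg hr₀ N)] at hle
  have := ENNReal.toReal_mono (measure_ne_top _ _) hle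
  rwa [ENNReal.toReal_mul, ENNReal.toReal_ofReal (pow_nonneg hr₀ N)] at this

theorem norm_sub_le_of_abs_sub_le {N : ℕ} {θ θ' : Simplex N} {r : ℝ} (hr : 0 ≤ r)
    (hle : ∀ x, |θ.1 x - θ'.1 x| ≤ r) : ‖θ.1 - θ'.1‖ ≤ (N + 1) * r := by
  rw [EuclideanSpace.norm_eq, Real.sqrt_le_left (by positivity)]
  calc ∑ x, ‖(θ.1 - θ'.1) x‖ ^ 2 ≤ ∑ _x : Fin (N + 1), r ^ 2 :=
        Finset.sum_le_sum fun x _ => pow_le_pow_left₀ (norm_nonneg _) (hle x) 2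
    _ = (N + 1) * r ^ 2 := by simp
    _ ≤ ((N + 1) * r) ^ 2 := by
        rw [mul_pow]
        gcongr
        nlinarith [Nat.cast_nonneg (α := ℝ) N]

/-- A set of parameters has a net of mesh `1 / n` of polynomial size. -/
theorem exists_net {N : ℕ} (A : Set (Simplex N)) {n : ℕ} (hn : 0 < n) :
    ∃ T : Finset (Simplex N), T.card ≤ (n + 1) ^ (N + 1) ∧ (∀ θ ∈ T, θ ∈ A) ∧
      ∀ θ ∈ A, ∃ θ' ∈ T, ∀ x, |θ.1 x - θ'.1 x| ≤ 1 / n := by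
  have hn' : (0 : ℝ) < n := by exact_mod_cast hn
  let cell : Simplex N → Fin (N + 1) → Fin (n + 1) := fun θ x =>
    ⟨⌊n * θ.1 x⌋₊, Nat.lt_succ_of_le (Nat.floor_le_of_le
      (mul_le_of_le_one_right hn'.le (apply_le_one θ x)))⟩
  -- One representative per occupied cell, chosen inside `A`: the decay estimate will be applied at
  -- the net points themselves.
  obtain ⟨s, hsA, hs⟩ := Set.exists_subset_bijOn A cell
  have hfin : s.Finite := Set.Finite.of_finite_image (Set.toFinite _) hs.injOn
  refine ⟨hfin.toFinset, ?_, fun θ hθ => hsA (hfin.mem_toFinset.1 hθ), fun θ hθ => ?_⟩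
  · calc hfin.toFinset.card ≤ (Finset.univ : Finset (Fin (N + 1) → Fin (n + 1))).card :=
          Finset.card_le_card_of_injOn cell (fun _ _ => Finset.mem_coe.2 (Finset.mem_univ _))
            (by simpa using hs.injOn)
      _ = _ := by simp
  · obtain ⟨θ', hθ', heq⟩ := hs.surjOn ⟨θ, hθ, rfl⟩
    refine ⟨θ', hfin.mem_toFinset.2 hθ', fun x => ?_⟩
    have hx : ⌊n * θ'.1 x⌋₊ = ⌊n * θ.1 x⌋₊ := congrArg Fin.val (congrFun heq x)
    have h1 := Nat.floor_le (mul_nonneg hn'.le (θ.2.2 x))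
    have h2 := Nat.lt_floor_add_one (n * θ.1 x)
    have h3 := Nat.floor_le (mul_nonneg hn'.le (θ'.2.2 x))
    have h4 := Nat.lt_floor_add_one (n * θ'.1 x)
    rw [hx] at h3 h4
    rw [abs_le, ← neg_div, div_le_iff₀ hn', le_div_iff₀ hn']
    constructor <;> linarith

/-! ### The posterior -/

/-- If the likelihood ratio is at most `M` outside `Ω`, then the posterior mass outside `Ω` is
at most a polynomial multiple of `M`. -/
theorem abs_posterior_sub_one_le {N : ℕ} {ε κ : ℝ} {η : Simplex N → ℝ} {θstar : Simplex N}
    (hη : IsPriorDensity η) {d B L : ℝ} (hB : 0 < B) (hL : 0 < L)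
    (hratio : ∀ θ θ' : Simplex N, ‖θ'.1 - θstar.1‖ < d → 0 < η θ' ∧ η θ / η θ' < B)
    {n : ℕ} (hn : 0 < n) (hd : (N + 1 : ℝ) * (1 / n) < d) (D : Data N n)
    (hLik : ∀ θ : Simplex N, (∀ x, |θ.1 x - θstar.1 x| ≤ 1 / n) →
      likelihood ε κ D θstar ≤ L * likelihood ε κ D θ)
    {Ω : Set (Simplex N)} (hΩ : MeasurableSet Ω) {M : ℝ} (hM : 0 ≤ M)
    (hout : ∀ θ ∉ Ω, likelihood ε κ D θ ≤ M * likelihood ε κ D θstar) :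
    |posterior ε κ η D Ω - 1| ≤ B ^ 2 * L * n ^ N * M := by
  have hn' : (0 : ℝ) < n := by exact_mod_cast hn
  have hn1 : (1 : ℝ) ≤ n := by exact_mod_cast hn
  have hd0 : 0 < d := lt_of_le_of_lt (by positivity) hd
  set ν := lebesgueSimplex N
  set ℓ := likelihood ε κ D
  set η₀ := η θstar
  have hη₀ : 0 < η₀ := (hratio θstar θstar (by simpa using hd0)).1
  -- The ratio bound leaves the numerator's point free, so at `θ' = θstar` it bounds `η` globally.
  have hη_le : ∀ θ, η θ ≤ B * η₀ := fun θ =>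
    ((div_lt_iff₀ hη₀).1 (hratio θ θstar (by simpa using hd0)).2).le
  have hℓ₀ : 0 < ℓ θstar := likelihood_pos ε κ D θstar
  -- A non-integrable function has integral `0` by convention, which contradicts total mass `1`.
  have hηint : Integrable η ν := by
    by_contra hcon
    have := hη.integral_eq_one
    rw [integral_undef hcon] at this
    exact zero_ne_one this
  have hV : 0 < ν.real Set.univ := by
    refine measureReal_nonneg.lt_of_ne' fun hV0 => ?_
    have h0 : ν Set.univ = 0 := (measureReal_eq_zero_iff (measure_ne_top _ _)).1 hV0
    have := hη.integral_eq_one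
    rw [show lebesgueSimplex N = 0 from Measure.measure_univ_eq_zero.1 h0,
      integral_zero_measure] at this
    exact zero_ne_one this
  have hint : Integrable (fun θ => η θ * ℓ θ) ν := by
    refine hηint.mul_bdd (c := 1) (continuous_likelihood ε κ D).aestronglyMeasurable
      (ae_of_all _ fun θ => ?_)
    rw [Real.norm_of_nonneg (likelihood_pos ε κ D θ).le]
    exact likelihood_le_one ε κ D θ
  have hnonneg : ∀ θ, 0 ≤ η θ * ℓ θ := fun θ =>
    mul_nonneg (hη.nonneg θ) (likelihood_pos ε κ D θ).le
  set A : Set (Simplex N) := {θ | ∀ x, |θ.1 x - θstar.1 x| ≤ 1 / n}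
  have hA : MeasurableSet A := by
    refine IsClosed.measurableSet ?_
    simp only [A, Set.ofPred_forall]
    exact isClosed_iInter fun x => isClosed_le (by fun_prop) (by fun_prop)
  -- On the cube `A` the prior loses at most a factor `B` and the likelihood a factor `L` relative
  -- to `θstar`.
  have hlow : η₀ * ℓ θstar / (B * L) * ((1 / n) ^ N * ν.real Set.univ) ≤ ∫ θ, η θ * ℓ θ ∂ν := by
    calc _ ≤ η₀ * ℓ θstar / (B * L) * ν.real A := by
          gcongr
          exact pow_mul_measure_univ_le θstar (by positivity)
            ((div_le_one hn').2 hn1)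
      _ = ∫ _ in A, η₀ * ℓ θstar / (B * L) ∂ν := by
          rw [setIntegral_const, smul_eq_mul, mul_comm]
      _ ≤ ∫ θ in A, η θ * ℓ θ ∂ν := by
          refine setIntegral_mono_on (integrable_const _) hint.integrableOn hA fun θ hθ => ?_
          obtain ⟨hpos, hlt⟩ := hratio θstar θ
            ((norm_sub_le_of_abs_sub_le (by positivity) hθ).trans_lt hd)
          rw [div_lt_iff₀ hpos] at hlt
          rw [div_le_iff₀ (by positivity)]
          calc η₀ * ℓ θstar ≤ (B * η θ) * (L * ℓ θ) :=
                mul_le_mul hlt.le (hLik θ hθ) hℓ₀.le (by positivity)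
            _ = _ := by ring
      _ ≤ _ := setIntegral_le_integral hint (ae_of_all _ hnonneg)
  have hI : 0 < ∫ θ, η θ * ℓ θ ∂ν := lt_of_lt_of_le (by positivity) hlow
  have hup : ∫ θ in Ωᶜ, η θ * ℓ θ ∂ν ≤ B * η₀ * (M * ℓ θstar) * ν.real Set.univ := by
    calc ∫ θ in Ωᶜ, η θ * ℓ θ ∂ν ≤ ∫ _ in Ωᶜ, B * η₀ * (M * ℓ θstar) ∂ν :=
          setIntegral_mono_on hint.integrableOn (integrable_const _) hΩ.compl fun θ hθ =>
            mul_le_mul (hη_le θ) (hout θ hθ) (likelihood_pos ε κ D θ).le (by positivity)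
      _ = B * η₀ * (M * ℓ θstar) * ν.real Ωᶜ := by
          rw [setIntegral_const, smul_eq_mul, mul_comm]
      _ ≤ _ := by gcongr; exacts [measure_ne_top _ _, Set.subset_univ _]
  have hpost : posterior ε κ η D Ω =
      (∫ θ in Ω, η θ * ℓ θ ∂ν) / ∫ θ, η θ * ℓ θ ∂ν := rfl
  have hsplit := integral_add_compl hΩ hint
  have hsub : posterior ε κ η D Ω - 1 =
      -((∫ θ in Ωᶜ, η θ * ℓ θ ∂ν) / ∫ θ, η θ * ℓ θ ∂ν) := by
    rw [hpost, div_sub_one hI.ne', ← neg_div]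
    congr 1
    linarith
  rw [hsub, abs_neg, abs_of_nonneg (div_nonneg (integral_nonneg hnonneg) hI.le),
    div_le_iff₀ hI]
  calc _ ≤ B * η₀ * (M * ℓ θstar) * ν.real Set.univ := hup
    _ = B ^ 2 * L * n ^ N * M *
        (η₀ * ℓ θstar / (B * L) * ((1 / n) ^ N * ν.real Set.univ)) := by
        rw [one_div, inv_pow]
        field_simp
    _ ≤ _ := by gcongr

/-! ### Posterior contraction -/

/-- With `x = n ^ b` this is the decay of `x ^ (k / b) * exp (-δ x)`. -/
theorem tendsto_pow_mul_exp_neg_mul_rpow (k : ℕ) {δ b : ℝ} (hδ : 0 < δ) (hb : 0 < b) :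
    Tendsto (fun n : ℕ => (n : ℝ) ^ k * Real.exp (-(δ * (n : ℝ) ^ b))) atTop (nhds 0) := by
  have h1 : Tendsto (fun n : ℕ => (n : ℝ) ^ b) atTop atTop :=
    (tendsto_rpow_atTop hb).comp tendsto_natCast_atTop_atTop
  refine ((tendsto_rpow_mul_exp_neg_mul_atTop_nhds_zero (k / b) δ hδ).comp h1).congr fun n => ?_
  simp only [Function.comp_apply]
  rw [← Real.rpow_mul (Nat.cast_nonneg n), mul_div_cancel₀ _ hb.ne', Real.rpow_natCast, neg_mul]

theorem measurable_data {N : ℕ} (n : ℕ) : Measurable (data (N := N) n) := by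
  unfold data
  fun_prop

/-- Non-asymptotic posterior contraction: the mass outside a set that contains a ball is unlikely
to be large. -/
theorem measure_le_abs_posterior_sub_one_le {N : ℕ} {ε κ : ℝ} {η : Simplex N → ℝ}
    {θstar θinit : Simplex N} {sel : Simplex N → ProperSubset N} {hsel : Measurable sel}
    {Q : (n : ℕ) → Kernel (Data N n × Simplex N) (Simplex N)} [∀ n, IsMarkovKernel (Q n)]
    (hη : IsPriorDensity η) {d B L δ : ℝ} (hB : 0 < B) (hL : 0 < L) (hδ : 0 < δ)
    (hratio : ∀ θ θ' : Simplex N, ‖θ'.1 - θstar.1‖ < d → 0 < η θ' ∧ η θ / η θ' < B)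
    {n : ℕ} (hn : 0 < n) (hd : (N + 1 : ℝ) * (1 / n) < d)
    (hLik : ∀ (D : Data N n) (θ θ' : Simplex N),
      (∀ x, |θ.1 x - θ'.1 x| ≤ 1 / n) → likelihood ε κ D θ ≤ L * likelihood ε κ D θ')
    (hdecay : ∀ θ : Simplex N,
      ∫⁻ ω, ENNReal.ofReal √(likelihood ε κ (data n ω) θ / likelihood ε κ (data n ω) θstar)
        ∂(law ε κ θstar θinit sel hsel Q) ≤
      ENNReal.ofReal (Real.exp (-(n * (δ * ‖θ.1 - θstar.1‖ ^ 2)))))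
    {Ω : Set (Simplex N)} (hΩ : MeasurableSet Ω) {r : ℝ}
    (hr : ∀ θ ∉ Ω, r ≤ ‖θ.1 - θstar.1‖ ^ 2) {e : ℝ} (he : 0 < e) :
    law ε κ θstar θinit sel hsel Q {ω | e ≤ |posterior ε κ η (data n ω) Ω - 1|} ≤
      ENNReal.ofReal (B * L * n ^ N * ((n + 1) ^ (N + 1) * Real.exp (-(n * (δ * r))))) /
        ENNReal.ofReal √e := by
  have hn1 : (1 : ℝ) ≤ n := by exact_mod_cast hn
  obtain ⟨T, hcard, hTΩ, hT⟩ := exists_net Ωᶜ hn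
  -- A finite sum in place of a supremum, so that its mean can be bounded termwise. Roots are summed
  -- because it is their means that decay.
  let Z : Data N n → ℝ := fun D => ∑ θ ∈ T, √(likelihood ε κ D θ / likelihood ε κ D θstar)
  have hZ : ∀ D, 0 ≤ Z D := fun D => Finset.sum_nonneg fun θ _ => Real.sqrt_nonneg _
  have hout : ∀ D, ∀ θ ∉ Ω, likelihood ε κ D θ ≤ L * Z D ^ 2 * likelihood ε κ D θstar := by
    intro D θ hθ
    obtain ⟨θ', hθ', hclose⟩ := hT θ hθ
    have hpos := likelihood_pos ε κ D θstar
    have h1 : √(likelihood ε κ D θ' / likelihood ε κ D θstar) ≤ Z D :=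
      Finset.single_le_sum (f := fun θ => √(likelihood ε κ D θ / likelihood ε κ D θstar))
        (fun θ _ => Real.sqrt_nonneg _) hθ'
    rw [Real.sqrt_le_left (hZ D), div_le_iff₀ hpos] at h1
    calc likelihood ε κ D θ ≤ L * likelihood ε κ D θ' := hLik D θ θ' hclose
      _ ≤ L * (Z D ^ 2 * likelihood ε κ D θstar) := by gcongr
      _ = _ := by ring
  have hpost : ∀ D : Data N n, |posterior ε κ η D Ω - 1| ≤ (B * L * n ^ N * Z D) ^ 2 := by
    intro D
    refine (abs_posterior_sub_one_le hη hB hL hratio hn hd D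
      (fun θ hθ => hLik D θstar θ fun x => by rw [abs_sub_comm]; exact hθ x) hΩ
      (mul_nonneg hL.le (sq_nonneg (Z D))) (hout D)).trans ?_
    -- A polynomial factor is wasted to make the bound a perfect square; Markov's inequality then
    -- applies to a multiple of `Z` at level `√e`.
    have h1 : (n : ℝ) ^ N ≤ ((n : ℝ) ^ N) ^ 2 := by
      have := one_le_pow₀ hn1 (n := N)
      nlinarith
    calc B ^ 2 * L * n ^ N * (L * Z D ^ 2) = B ^ 2 * L ^ 2 * Z D ^ 2 * (n : ℝ) ^ N := by ring
      _ ≤ B ^ 2 * L ^ 2 * Z D ^ 2 * ((n : ℝ) ^ N) ^ 2 := by gcongr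
      _ = _ := by ring
  -- Measurability is free because the variable factors through the finite space of data.
  have hWm : Measurable fun ω : ℕ → Record N =>
      ENNReal.ofReal (B * L * n ^ N * Z (data n ω)) :=
    (measurable_of_countable fun D : Data N n => ENNReal.ofReal (B * L * n ^ N * Z D)).comp
      (measurable_data n)
  have hmean : ∫⁻ ω, ENNReal.ofReal (B * L * n ^ N * Z (data n ω))
      ∂(law ε κ θstar θinit sel hsel Q) ≤
      ENNReal.ofReal (B * L * n ^ N * ((n + 1) ^ (N + 1) * Real.exp (-(n * (δ * r))))) := by
    have hc : 0 ≤ B * L * (n : ℝ) ^ N := by positivity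
    simp_rw [ENNReal.ofReal_mul hc]
    rw [lintegral_const_mul' _ _ ENNReal.ofReal_ne_top]
    gcongr
    simp only [Z]
    simp_rw [ENNReal.ofReal_sum_of_nonneg fun θ _ => Real.sqrt_nonneg _]
    rw [lintegral_finsetSum]
    · calc _ ≤ ∑ _θ ∈ T, ENNReal.ofReal (Real.exp (-(n * (δ * r)))) := by
            refine Finset.sum_le_sum fun θ hθ => (hdecay θ).trans ?_
            gcongr
            exact hr θ (hTΩ θ hθ)
        _ = T.card * ENNReal.ofReal (Real.exp (-(n * (δ * r)))) := by
            rw [Finset.sum_const, nsmul_eq_mul]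
        _ ≤ ((n + 1) ^ (N + 1) : ℕ) * ENNReal.ofReal (Real.exp (-(n * (δ * r)))) := by
            gcongr
        _ = _ := by
            rw [ENNReal.ofReal_mul (by positivity), ← ENNReal.ofReal_natCast]
            push_cast
            rfl
    · intro θ _
      exact (measurable_of_countable fun D : Data N n => ENNReal.ofReal
        √(likelihood ε κ D θ / likelihood ε κ D θstar)).comp (measurable_data n)
  calc law ε κ θstar θinit sel hsel Q {ω | e ≤ |posterior ε κ η (data n ω) Ω - 1|}
      ≤ law ε κ θstar θinit sel hsel Q
          {ω | ENNReal.ofReal √e ≤ ENNReal.ofReal (B * L * n ^ N * Z (data n ω))} := by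
        refine measure_mono fun ω hω => ?_
        have hZω := hZ (data n ω)
        exact ENNReal.ofReal_le_ofReal
          ((Real.sqrt_le_left (by positivity)).2 (le_trans hω (hpost _)))
    _ ≤ _ := meas_ge_le_lintegral_div hWm.aemeasurable
        (ENNReal.ofReal_pos.2 (Real.sqrt_pos.2 he)).ne' ENNReal.ofReal_ne_top
    _ ≤ _ := ENNReal.div_le_div_right hmean _

end AdOBEst

theorem mainTheorem1 (N : ℕ) (ε κ : ℝ) (hε : 0 < ε) (hκ₀ : 0 < κ) (hκ₁ : κ < 1) :
    ∃ c : ℝ, 0 < c ∧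
      ∀ (θstar θinit : AdOBEst.Simplex N) (η : AdOBEst.Simplex N → ℝ),
        AdOBEst.IsPriorDensity η →
        AdOBEst.PriorRatioBounded η θstar →
      ∀ (U : AdOBEst.Simplex N → AdOBEst.ProperSubset N → ℝ → ℝ)
        (sel : AdOBEst.Simplex N → AdOBEst.ProperSubset N) (hsel : Measurable sel),
        AdOBEst.IsBestSubsetRule U ε sel →
      ∀ (Q : (n : ℕ) → ProbabilityTheory.Kernel
            (AdOBEst.Data N n × AdOBEst.Simplex N) (AdOBEst.Simplex N))
        [∀ n, ProbabilityTheory.IsMarkovKernel (Q n)] (a : ℝ), 0 < a → a < 1 →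
        MeasureTheory.TendstoInMeasure (AdOBEst.law ε κ θstar θinit sel hsel Q)
          (fun (n : ℕ) ω => AdOBEst.posterior ε κ η (AdOBEst.data n ω)
            {θ | ‖θ.1 - θstar.1‖ ^ 2 ≤ c * (n : ℝ) ^ (-a)})
          Filter.atTop (fun _ => (1 : ℝ)) := by
  obtain ⟨L, hL, hLik⟩ := AdOBEst.exists_likelihood_le_mul N ε κ
  obtain ⟨δ, hδ, hdecay⟩ :=
    AdOBEst.exists_lintegral_sqrt_likelihood_div_le (N := N) hε hκ₀ hκ₁
  -- Any positive constant would do: it only rescales `δ` in the exponent `δ n ^ (1 - a)`.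
  refine ⟨1, one_pos, ?_⟩
  rintro θstar θinit η hη ⟨d, hd, B, hB, hratio⟩ U sel hsel - Q _ a - ha₁
  rw [tendstoInMeasure_iff_norm]
  intro e he
  -- The power `2N + 1` combines `N` from the volume of the cube and `N + 1` from the net; `2 ^ (N +
  -- 1)` comes from `n + 1 ≤ 2n`.
  have hlim : Tendsto (fun n : ℕ => ENNReal.ofReal (B * L * 2 ^ (N + 1) *
      ((n : ℝ) ^ (2 * N + 1) * Real.exp (-(δ * (n : ℝ) ^ (1 - a))))) / ENNReal.ofReal √e)
      atTop (nhds 0) := by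
    have h1 := ENNReal.tendsto_ofReal ((AdOBEst.tendsto_pow_mul_exp_neg_mul_rpow (2 * N + 1) hδ
      (sub_pos.2 ha₁)).const_mul (B * L * 2 ^ (N + 1)))
    have h2 := ENNReal.Tendsto.div_const h1 (b := ENNReal.ofReal √e)
      (Or.inr (ENNReal.ofReal_pos.2 (Real.sqrt_pos.2 he)).ne')
    simpa using h2
  -- Eventually the `1/n`-cube about `θstar` lies in the ball where the prior ratio is controlled.
  have hmesh : ∀ᶠ n : ℕ in atTop, (N + 1 : ℝ) * (1 / n) < d := by
    have := (tendsto_one_div_atTop_nhds_zero_nat (𝕜 := ℝ)).const_mul (N + 1 : ℝ)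
    rw [mul_zero] at this
    exact this.eventually_lt_const hd
  refine tendsto_of_tendsto_of_tendsto_of_le_of_le' tendsto_const_nhds hlim
    (Eventually.of_forall fun n => zero_le) ?_
  filter_upwards [hmesh, eventually_gt_atTop 0] with n hdn hn
  have hn' : (0 : ℝ) < n := by exact_mod_cast hn
  have hn1 : (1 : ℝ) ≤ n := by exact_mod_cast hn
  simp only [Real.norm_eq_abs, one_mul]
  refine (AdOBEst.measure_le_abs_posterior_sub_one_le hη hB hL hδ hratio hn hdn (hLik n)
    (fun θ => hdecay θstar θinit sel hsel Q θ n)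
    (IsClosed.measurableSet (isClosed_le (by fun_prop) (by fun_prop)))
    (r := (n : ℝ) ^ (-a)) (fun θ hθ => (not_le.1 hθ).le) he).trans ?_
  have hexp : (n : ℝ) * (δ * (n : ℝ) ^ (-a)) = δ * (n : ℝ) ^ (1 - a) := by
    rw [sub_eq_add_neg, Real.rpow_add hn', Real.rpow_one]
    ring
  rw [hexp]
  refine ENNReal.div_le_div_right (ENNReal.ofReal_le_ofReal ?_) _
  calc B * L * (n : ℝ) ^ N * (((n : ℝ) + 1) ^ (N + 1) * Real.exp (-(δ * (n : ℝ) ^ (1 - a))))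
      ≤ B * L * (n : ℝ) ^ N * ((2 * (n : ℝ)) ^ (N + 1) *
          Real.exp (-(δ * (n : ℝ) ^ (1 - a)))) := by
        gcongr
        linarith
    _ = _ := by
        rw [mul_pow]
        ring
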